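/- A semigroup presentation $(\mathcal S,\mathcal R)$ is a set $\mathcal S$ of letters with a set $\mathcal R$ of (unordered) relations $v=v'$ between nonempty words in $\mathcal S$; let $\langle\mathcal S\mid\mathcal R\rangle^+$ be the monoid it presents. The trivial relations $s=s$ with $s\in\mathcal S$ are considered to belong implicitly to $\mathcal R$. A signed word is a word in the alphabet $\mathcal S\cup\mathcal S^{-1}$; for a word $u=s_1\cdots s_n$ in $\mathcal S$, $u^{-1}$ is the signed word $s_n^{-1}\cdots s_1^{-1}$; $\varepsilon$ is the empty word. Right-reversing $\curvearrowright$ is the reflexive-transitive closure of the steps that replace a factor $s^{-1}s'$ ($s,s'\in\mathcal S$) of a signed word by $v'v^{-1}$, where $sv'=s'v$ is a relation; left-reversing is the reflexive-transitive closure of the steps that replace a factor $s's^{-1}$ by $v^{-1}v'$, where $vs'=v's$ is a relation (in both cases $s=s$ is allowed, so that $s^{-1}s$, respectively $ss^{-1}$, may be deleted). The right cube condition holds for $(u,u',u'')$ if, for all words $v,v'$ in $\mathcal S$, $u^{-1}u''u''^{-1}u'\curvearrowright v'v^{-1}$ implies $(uv')^{-1}(u'v)\curvearrowright\varepsilon$.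 The left cube condition holds for $(u,u',u'')$ if, for all words $v,v'$ in $\mathcal S$, whenever $u'u''^{-1}u''u^{-1}$ left-reverses to $v^{-1}v'$, the word $(vu')(v'u)^{-1}$ left-reverses to $\varepsilon$. Theorem. Assume that a group $G$ admits a semigroup presentation $(\mathcal S,\mathcal R)$ such that: 1. $\mathcal R$ contains no relation $sv=sv'$ or $vs=v's$ with $s\in\mathcal S$ and $v\ne v'$; 2. there is $\lambda:\langle\mathcal S\mid\mathcal R\rangle^+\to\mathbb N$ with $\lambda(xy)\ge\lambda(x)+\lambda(y)$ for all $x,y$ and $\lambda(s)\ge1$ for every $s\in\mathcal S$; 3. $(\mathcal S,\mathcal R)$ is complemented: for all $s,s'\in\mathcal S$ there is at most one relation of the form $sv'=s'v$, the trivial relations $s=s$ being counted (so that, for $s=s'$, there is none but $s=s$); 4. the left and the right cube conditions hold for every triple of letters; 5. there is a set $\widehat{\mathcal S}$ of words in $\mathcal S$ that includes $\mathcal S$ and is such that for all $u,u'\in\widehat{\mathcal S}$ there are $v,v'\in\widehat{\mathcal S}$ with $u^{-1}u'\curvearrowright v'v^{-1}$. Then, for every signed word $w$, there is a unique pair $(v,v')$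 of words in $\mathcal S$ such that $w\curvearrowright v'v^{-1}$; and, for this pair, $w$ represents $1$ in $G$ if and only if $v^{-1}v'\curvearrowright\varepsilon$. -/

import Mathlib

/-! Semigroup presentations and subword reversing.

A semigroup presentation consists of a type `S` of letters and a set `R` of pairs of words
(lists of letters); a pair `(v, v')` of `R` is the relation `v = v'`, and relations are unordered.
A signed word is a list of elements of `S × Bool`: `(s, true)` is the letter `s` and `(s, false)` is
the letter `s⁻¹` (the convention of `FreeGroup`). -/

namespace SubwordReversing

variable {S : Type*}

/-- All relations of `R` are between nonempty words. -/
def IsSemigroupPresentation (R : Set (List S × List S)) : Prop :=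
  ∀ p ∈ R, p.1 ≠ [] ∧ p.2 ≠ []

/-- `v = v'` is, up to exchanging the two sides, a relation of `R`. -/
def IsRelation (R : Set (List S × List S)) (v v' : List S) : Prop :=
  (v, v') ∈ R ∨ (v', v) ∈ R

/-- `v = v'` is a relation of `R` or one of the trivial relations `s = s` between letters, which
are considered to belong implicitly to the presentation. -/
def IsRelationOrTrivial (R : Set (List S × List S)) (v v' : List S) : Prop :=
  IsRelation R v v' ∨ ∃ s : S, v = [s] ∧ v' = [s]

/-- The monoid presented by `(S, R)`. -/
abbrev PresMonoid (R : Set (List S × List S)) : Type _ :=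
  PresentedMonoid (fun a b : FreeMonoid S => (a.toList, b.toList) ∈ R)

/-- A positive word viewed as a signed word. -/
def pos (u : List S) : List (S × Bool) :=
  u.map fun s => (s, true)

/-- The inverse `u⁻¹` of a positive word `u`: each letter is inverted and the order is reversed. -/
def neg (u : List S) : List (S × Bool) :=
  (u.map fun s => (s, false)).reverse

/-- The group presented by `(S, R)`. -/
abbrev PresGroup (R : Set (List S × List S)) : Type _ :=
  PresentedGroup
    {g : FreeGroup S | ∃ p ∈ R, g = FreeGroup.mk (pos p.1) * (FreeGroup.mk (pos p.2))⁻¹}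

/-- The element of the presented group that is represented by a signed word. -/
def evalGroup (R : Set (List S × List S)) (w : List (S × Bool)) : PresGroup R :=
  PresentedGroup.mk _ (FreeGroup.mk w)

/-- One step of right-reversing: a factor `s⁻¹ s'` is replaced by `v' v⁻¹`, where `s v' = s' v` is a
relation (possibly the trivial relation `s = s`). -/
inductive RightStep (R : Set (List S × List S)) : List (S × Bool) → List (S × Bool) → Prop
  | step (x y : List (S × Bool)) (s s' : S) (v v' : List S)
      (h : IsRelationOrTrivial R (s :: v') (s' :: v)) :
      RightStep R (x ++ neg [s] ++ pos [s'] ++ y) (x ++ pos v' ++ neg v ++ y)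

/-- One step of left-reversing: a factor `s' s⁻¹` is replaced by `v⁻¹ v'`, where `v s' = v' s` is a
relation (possibly the trivial relation `s = s`). -/
inductive LeftStep (R : Set (List S × List S)) : List (S × Bool) → List (S × Bool) → Prop
  | step (x y : List (S × Bool)) (s s' : S) (v v' : List S)
      (h : IsRelationOrTrivial R (v ++ [s']) (v' ++ [s])) :
      LeftStep R (x ++ pos [s'] ++ neg [s] ++ y) (x ++ neg v ++ pos v' ++ y)

/-- `w` right-reverses to `w'`, in finitely many steps (possibly none). -/
def RightReverses (R : Set (List S × List S)) : List (S × Bool) → List (S × Bool) → Prop :=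
  Relation.ReflTransGen (RightStep R)

/-- `w` left-reverses to `w'`, in finitely many steps (possibly none). -/
def LeftReverses (R : Set (List S × List S)) : List (S × Bool) → List (S × Bool) → Prop :=
  Relation.ReflTransGen (LeftStep R)

/-- The right cube condition for `(u, u', u'')`: whenever `u⁻¹ u'' u''⁻¹ u'` right-reverses to
`v' v⁻¹`, the word `(u v')⁻¹ (u' v)` right-reverses to the empty word. -/
def RightCube (R : Set (List S × List S)) (u u' u'' : List S) : Prop :=
  ∀ v v' : List S,
    RightReverses R (neg u ++ pos u'' ++ neg u'' ++ pos u') (pos v' ++ neg v) →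
      RightReverses R (neg (u ++ v') ++ pos (u' ++ v)) []

/-- The left cube condition for `(u, u', u'')`: whenever `u' u''⁻¹ u'' u⁻¹` left-reverses to
`v⁻¹ v'`, the word `(v u') (v' u)⁻¹` left-reverses to the empty word. -/
def LeftCube (R : Set (List S × List S)) (u u' u'' : List S) : Prop :=
  ∀ v v' : List S,
    LeftReverses R (pos u' ++ neg u'' ++ pos u'' ++ neg u) (neg v ++ pos v') →
      LeftReverses R (pos (v ++ u') ++ neg (v' ++ u)) []

/-- For all letters `s`, `s'`, there is at most one relation of the form `s v' = s' v`, the trivial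
relations `s = s` being counted. -/
def Complemented (R : Set (List S × List S)) : Prop :=
  ∀ (s s' : S) (v v' y y' : List S),
    IsRelationOrTrivial R (s :: v') (s' :: v) → IsRelationOrTrivial R (s :: y') (s' :: y) →
      v' = y' ∧ v = y

end SubwordReversing

namespace SubwordReversing

universe u

variable {S : Type*} {R : Set (List S × List S)}

/-! A right-reversing of u⁻¹v to v'u'⁻¹ fills a grid whose tiles are relations, so it proves uv' ≡
vu' in the monoid (`RightSteps.wordEqv`); in particular u⁻¹v ↷ ε forces u ≡ v.

The heart is the converse, completeness (`WordEqv.rightReverses`): u ≡ v implies u⁻¹v ↷ ε. The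
delicate point is that the relation u⁻¹v ↷ ε is transitive, which follows from the cube condition on
letters by induction on the pseudolength (`rightReverses_trans_of_cube`).

Completeness and the absence of relations sv = sv' with v ≠ v' give left cancellation; applied to
the mirror presentation, the same argument gives right cancellation. The closed set of words makes
every signed word reverse to some v'v⁻¹, hence provides common right multiples. By Ore's theorem the
monoid embeds in a group, and therefore in G. So w = v'v⁻¹ is 1 in G iff v ≡ v', iff v⁻¹v' ↷ ε.

Uniqueness of (v, v') is confluence: complementedness gives a diamond property
(`Complemented.diamond`), and no step applies to a positive-negative word. -/

/-! ### Positive, negative and positive-negative words. -/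

@[simp] theorem pos_nil : pos ([] : List S) = [] := rfl

@[simp] theorem neg_nil : neg ([] : List S) = [] := rfl

@[simp] theorem pos_cons (s : S) (u : List S) : pos (s :: u) = (s, true) :: pos u := rfl

@[simp] theorem neg_cons (s : S) (u : List S) : neg (s :: u) = neg u ++ [(s, false)] := by
  simp [neg]

@[simp] theorem pos_append (u v : List S) : pos (u ++ v) = pos u ++ pos v := by
  simp [pos]

@[simp] theorem neg_append (u v : List S) : neg (u ++ v) = neg v ++ neg u := by
  simp [neg]

@[simp] theorem pos_eq_nil {u : List S} : pos u = [] ↔ u = [] := by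
  simp [pos]

@[simp] theorem neg_eq_nil {u : List S} : neg u = [] ↔ u = [] := by
  simp [neg]

theorem neg_eq_cons {u : List S} {c : S × Bool} {w : List (S × Bool)} (h : neg u = c :: w) :
    ∃ (s : S) (u' : List S), c = (s, false) ∧ u = u' ++ [s] ∧ w = neg u' := by
  induction u using List.reverseRecOn with
  | nil => simp at h
  | append_singleton u' s =>
    simp at h
    exact ⟨s, u', h.1.symm, rfl, h.2.symm⟩

theorem pos_append_neg_inj {p q p' q' : List S} (h : pos p ++ neg q = pos p' ++ neg q') :
    p = p' ∧ q = q' := by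
  induction p generalizing p' with
  | nil =>
    cases p' with
    | nil => simpa [neg, List.map_inj_right] using h
    | cons t p' =>
      obtain ⟨s, u', h1, -⟩ := neg_eq_cons (by simpa using h)
      simp at h1
  | cons s p ih =>
    cases p' with
    | nil =>
      obtain ⟨s, u', h1, -⟩ := neg_eq_cons (by simpa using h.symm)
      simp at h1
    | cons t p' =>
      simp at h
      obtain ⟨rfl, rfl⟩ := ih h.2
      simp [h.1]

/-- A factorization of a positive-negative word consists of positive-negative words. -/
theorem eq_pos_append_neg_of_append {x y : List (S × Bool)} {p q : List S}
    (h : x ++ y = pos p ++ neg q) :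
    ∃ p₁ q₁ p₂ q₂, x = pos p₁ ++ neg q₁ ∧ y = pos p₂ ++ neg q₂ := by
  induction x generalizing p with
  | nil => exact ⟨[], [], p, q, rfl, h⟩
  | cons c x ih =>
    cases p with
    | cons s p =>
      simp at h
      obtain ⟨p₁, q₁, p₂, q₂, rfl, rfl⟩ := ih h.2
      exact ⟨s :: p₁, q₁, p₂, q₂, by simp [h.1], rfl⟩
    | nil =>
      clear ih
      rw [pos_nil, List.nil_append, neg, ← List.map_reverse] at h
      obtain ⟨a, b, -, ha, hb⟩ := List.map_eq_append_iff.1 h.symm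
      exact ⟨[], a.reverse, [], b.reverse, by simp [neg, ha], by simp [neg, hb]⟩

theorem IsRelationOrTrivial.symm {v v' : List S} (h : IsRelationOrTrivial R v v') :
    IsRelationOrTrivial R v' v := by
  rcases h with h | ⟨s, rfl, rfl⟩
  · exact Or.inl h.symm
  · exact Or.inr ⟨s, rfl, rfl⟩

/-! ### Single right-reversing steps. -/

namespace RightStep

theorem head {s s' : S} {v v' : List S} (h : IsRelationOrTrivial R (s :: v') (s' :: v))
    (y : List (S × Bool)) :
    RightStep R ((s, false) :: (s', true) :: y) (pos v' ++ neg v ++ y) := by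
  simpa using RightStep.step [] y s s' v v' h

theorem append_left {w w' : List (S × Bool)} (x : List (S × Bool)) (h : RightStep R w w') :
    RightStep R (x ++ w) (x ++ w') := by
  obtain ⟨x', y, s, s', v, v', h⟩ := h
  simpa using RightStep.step (x ++ x') y s s' v v' h

theorem append_right {w w' : List (S × Bool)} (h : RightStep R w w') (y : List (S × Bool)) :
    RightStep R (w ++ y) (w' ++ y) := by
  obtain ⟨x', y', s, s', v, v', h⟩ := h
  simpa using RightStep.step x' (y' ++ y) s s' v v' h

theorem not_nil {z : List (S × Bool)} : ¬ RightStep R [] z := by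
  generalize h : ([] : List (S × Bool)) = w
  rintro ⟨⟩
  simp at h

theorem cons_cases {c : S × Bool} {w z : List (S × Bool)} (h : RightStep R (c :: w) z) :
    (∃ s s' v v' y, c = (s, false) ∧ w = (s', true) :: y ∧
      IsRelationOrTrivial R (s :: v') (s' :: v) ∧ z = pos v' ++ neg v ++ y) ∨
    ∃ w', RightStep R w w' ∧ z = c :: w' := by
  generalize hx : c :: w = x at h
  obtain ⟨x', y, s, s', v, v', h⟩ := h
  cases x' with
  | nil =>
    simp at hx
    exact Or.inl ⟨s, s', v, v', y, hx.1, hx.2, h, by simp⟩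
  | cons d x' =>
    simp at hx
    refine Or.inr ⟨x' ++ pos v' ++ neg v ++ y, ?_, by simp [hx]⟩
    simpa [hx] using RightStep.step x' y s s' v v' h

/-- Besides steps inside a factor, only a step straddling the border can occur: this is the sole
interaction between adjacent factors. -/
theorem append_cases {x y z : List (S × Bool)} (h : RightStep R (x ++ y) z) :
    (∃ x', RightStep R x x' ∧ z = x' ++ y) ∨ (∃ y', RightStep R y y' ∧ z = x ++ y') ∨
    ∃ x₀ s s' v v' y₀, x = x₀ ++ [(s, false)] ∧ y = (s', true) :: y₀ ∧
      IsRelationOrTrivial R (s :: v') (s' :: v) ∧ z = x₀ ++ (pos v' ++ neg v ++ y₀) := by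
  induction x generalizing z with
  | nil => exact Or.inr (Or.inl ⟨z, h, rfl⟩)
  | cons c x ih =>
    rcases cons_cases h with ⟨s, s', v, v', y₀, rfl, hw, hr, rfl⟩ | ⟨w', hw, rfl⟩
    · cases x with
      | nil => exact Or.inr (Or.inr ⟨[], s, s', v, v', y₀, rfl, hw, hr, rfl⟩)
      | cons d x =>
        simp at hw
        obtain ⟨rfl, rfl⟩ := hw
        exact Or.inl ⟨_, head hr x, by simp⟩
    · rcases ih hw with ⟨x', hx, rfl⟩ | ⟨y', hy, rfl⟩ | ⟨x₀, s, s', v, v', y₀, rfl, rfl, hr, rfl⟩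
      · exact Or.inl ⟨_, hx.append_left [c], rfl⟩
      · exact Or.inr (Or.inl ⟨y', hy, rfl⟩)
      · exact Or.inr (Or.inr ⟨c :: x₀, s, s', v, v', y₀, rfl, rfl, hr, rfl⟩)

theorem of_pos_append {p : List S} {w z : List (S × Bool)} (h : RightStep R (pos p ++ w) z) :
    ∃ w', RightStep R w w' ∧ z = pos p ++ w' := by
  induction p generalizing z with
  | nil => exact ⟨z, h, rfl⟩
  | cons s p ih =>
    rcases cons_cases h with ⟨_, _, _, _, _, h, -⟩ | ⟨w', hw, rfl⟩
    · simp at h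
    · obtain ⟨w', hw', rfl⟩ := ih hw
      exact ⟨w', hw', rfl⟩

/-- Right-reversing steps are compatible with formal inversion of signed words. -/
theorem invRev {w w' : List (S × Bool)} (h : RightStep R w w') :
    RightStep R (FreeGroup.invRev w) (FreeGroup.invRev w') := by
  have hp (u : List S) : FreeGroup.invRev (pos u) = neg u := by
    simp [FreeGroup.invRev, pos, neg, Function.comp_def]
  have hn (u : List S) : FreeGroup.invRev (neg u) = pos u := by
    rw [← hp, FreeGroup.invRev_invRev]
  obtain ⟨x', y, s, s', v, v', h⟩ := h
  simp only [FreeGroup.invRev_append, hp, hn]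
  simpa using RightStep.step (FreeGroup.invRev y) (FreeGroup.invRev x') s' s v' v h.symm

theorem neg_not {q : List S} {z : List (S × Bool)} : ¬ RightStep R (neg q) z := by
  intro h
  have hp : FreeGroup.invRev (neg q) = pos q := by
    simp [FreeGroup.invRev, pos, neg, Function.comp_def]
  have := h.invRev
  rw [hp, ← List.append_nil (pos q)] at this
  obtain ⟨_, h, -⟩ := this.of_pos_append
  exact not_nil h

theorem not_pos_append_neg {p q : List S} {z : List (S × Bool)} :
    ¬ RightStep R (pos p ++ neg q) z := fun h => by
  obtain ⟨_, h, -⟩ := h.of_pos_append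
  exact neg_not h

theorem of_append_neg {q : List S} {w z : List (S × Bool)} (h : RightStep R (w ++ neg q) z) :
    ∃ w', RightStep R w w' ∧ z = w' ++ neg q := by
  rcases h.append_cases with h | ⟨_, h, -⟩ | ⟨_, _, _, _, _, _, -, h, -⟩
  · exact h
  · exact absurd h neg_not
  · obtain ⟨_, _, h, -⟩ := neg_eq_cons h
    simp at h

end RightStep

/-! ### Counted reversings and their reordering. -/

/-- `w` right-reverses to `w'` in exactly `n` steps. -/
def RightSteps (R : Set (List S × List S)) : ℕ → List (S × Bool) → List (S × Bool) → Prop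
  | 0, w, w' => w = w'
  | n + 1, w, w' => ∃ z, RightStep R w z ∧ RightSteps R n z w'

namespace RightSteps

theorem trans {m n : ℕ} {x y z : List (S × Bool)} (h : RightSteps R m x y)
    (h' : RightSteps R n y z) : RightSteps R (m + n) x z := by
  induction m generalizing x with
  | zero => cases h; simpa using h'
  | succ m ih =>
    obtain ⟨t, ht, h⟩ := h
    rw [Nat.succ_add]
    exact ⟨t, ht, ih h⟩

theorem append {n : ℕ} {w w' : List (S × Bool)} (x y : List (S × Bool))
    (h : RightSteps R n w w') : RightSteps R n (x ++ w ++ y) (x ++ w' ++ y) := by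
  induction n generalizing w with
  | zero => cases h; rfl
  | succ n ih =>
    obtain ⟨z, hz, h⟩ := h
    exact ⟨_, (hz.append_left x).append_right y, ih h⟩

theorem reverses {n : ℕ} {w w' : List (S × Bool)} (h : RightSteps R n w w') :
    RightReverses R w w' := by
  induction n generalizing w with
  | zero => cases h; exact .refl
  | succ n ih =>
    obtain ⟨z, hz, h⟩ := h
    exact .head hz (ih h)

/-- A step needs a negative letter to the left of a positive one, so a positive prefix and a
negative suffix are inert. -/
theorem context {n : ℕ} {p q p' q' : List S} {w : List (S × Bool)}
    (h : RightSteps R n (pos p ++ w ++ neg q) (pos p' ++ neg q')) :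
    ∃ a b, RightSteps R n w (pos a ++ neg b) ∧ p' = p ++ a ∧ q' = q ++ b := by
  induction n generalizing w with
  | zero =>
    have h : pos p ++ w ++ neg q = pos p' ++ neg q' := h
    obtain ⟨p₁, q₁, p₂, q₂, h1, h2⟩ := eq_pos_append_neg_of_append h
    cases p₂ with
    | cons s p₂ =>
      obtain ⟨_, _, h, -⟩ := neg_eq_cons h2
      simp at h
    | nil =>
    have h3 := eq_pos_append_neg_of_append h1
    obtain ⟨p₃, q₃, p₄, q₄, h3, rfl⟩ := h3
    obtain ⟨rfl, hq⟩ : p = p₃ ∧ [] = q₃ := pos_append_neg_inj (by simpa using h3)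
    refine ⟨p₄, q₄, rfl, ?_⟩
    have := pos_append_neg_inj (p := p ++ p₄) (q := q ++ q₄) (p' := p') (q' := q') (by simpa using h)
    exact ⟨this.1.symm, this.2.symm⟩
  | succ n ih =>
    obtain ⟨z, hz, h⟩ := h
    obtain ⟨z₁, hz₁, rfl⟩ := hz.of_append_neg
    obtain ⟨z₂, hz₂, rfl⟩ := hz₁.of_pos_append
    obtain ⟨a, b, h1, h2⟩ := ih h
    exact ⟨a, b, ⟨z₂, hz₂, h1⟩, h2⟩

/-- A reversing of a product to a positive-negative word can be reordered so as to start with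
reversings of the factors. -/
theorem split {n : ℕ} {x y : List (S × Bool)} {p q : List S}
    (h : RightSteps R n (x ++ y) (pos p ++ neg q)) :
    ∃ p₁ q₁ p₂ q₂ n₁ n₂ n₃, RightSteps R n₁ x (pos p₁ ++ neg q₁) ∧
      RightSteps R n₂ y (pos p₂ ++ neg q₂) ∧
      RightSteps R n₃ (pos p₁ ++ neg q₁ ++ (pos p₂ ++ neg q₂)) (pos p ++ neg q) ∧
      n₁ + n₂ + n₃ = n := by
  induction n using Nat.strong_induction_on generalizing x y p q with
  | _ n ih =>
  cases n with
  | zero =>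
    have h : x ++ y = pos p ++ neg q := h
    obtain ⟨p₁, q₁, p₂, q₂, rfl, rfl⟩ := eq_pos_append_neg_of_append h
    exact ⟨p₁, q₁, p₂, q₂, 0, 0, 0, rfl, rfl, h, rfl⟩
  | succ n =>
    obtain ⟨z, hz, h⟩ := h
    rcases hz.append_cases with ⟨x', hx, rfl⟩ | ⟨y', hy, rfl⟩ |
      ⟨x₀, s, s', v, v', y₀, rfl, rfl, hr, rfl⟩
    · obtain ⟨p₁, q₁, p₂, q₂, n₁, n₂, n₃, h1, h2, h3, e⟩ := ih n (Nat.lt_succ_self n) h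
      exact ⟨p₁, q₁, p₂, q₂, n₁ + 1, n₂, n₃, ⟨x', hx, h1⟩, h2, h3, by omega⟩
    · obtain ⟨p₁, q₁, p₂, q₂, n₁, n₂, n₃, h1, h2, h3, e⟩ := ih n (Nat.lt_succ_self n) h
      exact ⟨p₁, q₁, p₂, q₂, n₁, n₂ + 1, n₃, h1, ⟨y', hy, h2⟩, h3, by omega⟩
    · obtain ⟨p₁, q₁, p₂, q₂, n₁, n₂, n₃, h1, h2, h3, e⟩ := ih n (Nat.lt_succ_self n) h
      obtain ⟨p₃, q₃, p₄, q₄, m₁, m₂, m₃, k1, k2, k3, e'⟩ := ih n₂ (by omega) h2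
      -- The straddling step, counted by the 1, is postponed until `x₀` and `y₀` are reversed; the
      -- reversing of `v' v⁻¹` and the gluing steps come after it.
      refine ⟨p₁, s :: q₁, s' :: p₄, q₄, n₁, m₂, 1 + (m₁ + (m₃ + n₃)), ?_, ?_, ?_, by omega⟩
      · simpa using h1.append [] [(s, false)]
      · simpa using k2.append [(s', true)] []
      · have e1 : RightSteps R 1 (pos p₁ ++ neg (s :: q₁) ++ (pos (s' :: p₄) ++ neg q₄))
            (pos p₁ ++ neg q₁ ++ (pos v' ++ neg v) ++ (pos p₄ ++ neg q₄)) :=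
          ⟨_, by simpa using RightStep.step (pos p₁ ++ neg q₁) (pos p₄ ++ neg q₄) s s' v v' hr, rfl⟩
        refine e1.trans ((k1.append _ _).trans ?_)
        have e2 := k3.append (pos p₁ ++ neg q₁) []
        simp only [List.append_nil, ← List.append_assoc] at e2 h3 ⊢
        exact e2.trans h3

end RightSteps

namespace RightSteps

theorem eq_of_pos_append_neg {n : ℕ} {p q : List S} {w : List (S × Bool)}
    (h : RightSteps R n (pos p ++ neg q) w) : w = pos p ++ neg q := by
  cases n with
  | zero => exact h.symm
  | succ n =>
    obtain ⟨z, hz, -⟩ := h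
    exact absurd hz RightStep.not_pos_append_neg

theorem split_middle {n : ℕ} {x w y : List (S × Bool)} {p q : List S}
    (h : RightSteps R n (x ++ (w ++ y)) (pos p ++ neg q)) :
    ∃ e f n₁ n₂, RightSteps R n₁ w (pos e ++ neg f) ∧
      RightSteps R n₂ (x ++ (pos e ++ neg f) ++ y) (pos p ++ neg q) ∧ n₁ + n₂ = n := by
  obtain ⟨p₁, q₁, p₂, q₂, n₁, n₂, n₃, h1, h2, h3, rfl⟩ := h.split
  obtain ⟨e, f, p₃, q₃, m₁, m₂, m₃, k1, k2, k3, rfl⟩ := h2.split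
  refine ⟨e, f, m₁, m₂ + (n₁ + (m₃ + n₃)), k1, ?_, by omega⟩
  have e1 := k2.append (x ++ (pos e ++ neg f)) []
  have e2 := h1.append [] (pos e ++ neg f ++ (pos p₃ ++ neg q₃))
  have e3 := k3.append (pos p₁ ++ neg q₁) []
  simp only [List.append_nil, List.nil_append, List.append_assoc] at e1 e2 e3 h3 ⊢
  exact e1.trans (e2.trans (e3.trans h3))

/-- The two-letter word is not positive-negative, so a step must occur, and its result is already
terminal. The bound `0 < n` makes the induction of `RightSteps.wordEqv` decrease. -/
theorem letters {n : ℕ} {s t : S} {a b : List S}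
    (h : RightSteps R n [(s, false), (t, true)] (pos a ++ neg b)) :
    0 < n ∧ IsRelationOrTrivial R (s :: a) (t :: b) := by
  cases n with
  | zero =>
    have h : [(s, false), (t, true)] = pos a ++ neg b := h
    obtain ⟨rfl, rfl⟩ : a = [] ∧ b = [] := by
      cases a with
      | cons c a => simp at h
      | nil =>
        obtain ⟨_, u, -, -, h⟩ := neg_eq_cons h.symm
        obtain ⟨_, _, h, -⟩ := neg_eq_cons h.symm
        simp at h
    simp at h
  | succ n =>
    refine ⟨Nat.succ_pos n, ?_⟩
    obtain ⟨z, hz, h⟩ := h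
    rcases hz.cons_cases with ⟨s', t', v, v', y, h1, h2, hr, rfl⟩ | ⟨w', hw, -⟩
    · simp at h1 h2
      obtain ⟨rfl, rfl⟩ := h2
      subst h1
      rw [List.append_nil] at h
      obtain ⟨rfl, rfl⟩ := pos_append_neg_inj h.eq_of_pos_append_neg
      exact hr
    · exact absurd hw (RightStep.not_pos_append_neg (p := [t]) (q := []))

end RightSteps

/-! ### Word equivalence and soundness of reversing. -/

/-- The congruence on words generated by the relations of `R`. -/
inductive WordEqv (R : Set (List S × List S)) : List S → List S → Prop
  | rel (p q : List S) (h : (p, q) ∈ R) : WordEqv R p q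
  | refl (u : List S) : WordEqv R u u
  | symm {u v : List S} (h : WordEqv R u v) : WordEqv R v u
  | trans {u v w : List S} (h : WordEqv R u v) (h' : WordEqv R v w) : WordEqv R u w
  | append {u v u' v' : List S} (h : WordEqv R u v) (h' : WordEqv R u' v') :
      WordEqv R (u ++ u') (v ++ v')

theorem IsRelationOrTrivial.wordEqv {u v : List S} (h : IsRelationOrTrivial R u v) :
    WordEqv R u v := by
  rcases h with (h | h) | ⟨s, rfl, rfl⟩
  · exact .rel _ _ h
  · exact (WordEqv.rel _ _ h).symm
  · exact .refl _

theorem WordEqv.append_left {u v : List S} (x : List S) (h : WordEqv R u v) :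
    WordEqv R (x ++ u) (x ++ v) := (WordEqv.refl x).append h

theorem WordEqv.append_right {u v : List S} (h : WordEqv R u v) (x : List S) :
    WordEqv R (u ++ x) (v ++ x) := h.append (WordEqv.refl x)

/-- The grid is cut into four: the corner tile of the two first letters, the two strips next to it,
and the remaining rectangle. The corner uses at least one step, so induction applies to the other
three. -/
theorem RightSteps.wordEqv {n : ℕ} {u v u' v' : List S}
    (h : RightSteps R n (neg u ++ pos v) (pos v' ++ neg u')) :
    WordEqv R (u ++ v') (v ++ u') := by
  induction n using Nat.strong_induction_on generalizing u v u' v' with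
  | _ n ih =>
  cases u with
  | nil =>
    obtain ⟨rfl, rfl⟩ := pos_append_neg_inj
      (RightSteps.eq_of_pos_append_neg (p := v) (q := []) (by simpa using h))
    simpa using WordEqv.refl _
  | cons s u =>
  cases v with
  | nil =>
    obtain ⟨rfl, rfl⟩ := pos_append_neg_inj
      (RightSteps.eq_of_pos_append_neg (p := []) (q := s :: u) (by simpa using h))
    simpa using WordEqv.refl _
  | cons t v =>
  have h' : RightSteps R n (neg u ++ ([(s, false), (t, true)] ++ pos v)) (pos v' ++ neg u') := by
    simpa using h
  obtain ⟨a, b, n₁, n₂, h1, h2, rfl⟩ := h'.split_middle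
  obtain ⟨hn, hr⟩ := h1.letters
  have h2' : RightSteps R n₂ ((neg u ++ pos a) ++ (neg b ++ pos v)) (pos v' ++ neg u') := by
    simpa using h2
  obtain ⟨a₁, u₁, v₁, b₁, m₁, m₂, m₃, k1, k2, k3, rfl⟩ := h2'.split
  obtain ⟨v₂, u₂, k4, rfl, rfl⟩ := RightSteps.context (p := a₁) (q := b₁) (w := neg u₁ ++ pos v₁)
    (by simpa using k3)
  have e1 := (ih m₁ (by omega) k1).append_right v₂
  have e2 := (ih m₂ (by omega) k2).append_right u₂
  have e3 := ih m₃ (by omega) k4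
  simp only [List.append_assoc] at e1 e2
  have e4 := hr.wordEqv.append_right (u₁ ++ v₂)
  have e5 := e3.append_left b
  -- The chain is s u a₁ v₂ ≡ s a u₁ v₂ ≡ t b u₁ v₂ ≡ t b v₁ u₂ ≡ t v b₁ u₂.
  have l := (e1.append_left [s]).trans (by simpa using e4)
  have r := (e5.trans e2).append_left [t]
  simpa using l.trans (by simpa using r)

/-! ### Calculus of reversings to the empty word. -/

theorem rightReverses_iff {w w' : List (S × Bool)} :
    RightReverses R w w' ↔ ∃ n, RightSteps R n w w' := by
  refine ⟨fun h => ?_, fun ⟨n, h⟩ => h.reverses⟩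
  induction h using Relation.ReflTransGen.head_induction_on with
  | refl => exact ⟨0, rfl⟩
  | head hz _ ih =>
    obtain ⟨n, h⟩ := ih
    exact ⟨n + 1, _, hz, h⟩

namespace RightReverses

theorem trans {x y z : List (S × Bool)} (h : RightReverses R x y) (h' : RightReverses R y z) :
    RightReverses R x z := Relation.ReflTransGen.trans h h'

theorem append {w w' : List (S × Bool)} (x y : List (S × Bool)) (h : RightReverses R w w') :
    RightReverses R (x ++ w ++ y) (x ++ w' ++ y) := by
  obtain ⟨n, h⟩ := rightReverses_iff.1 h
  exact (h.append x y).reverses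

theorem append_left {w w' : List (S × Bool)} (x : List (S × Bool)) (h : RightReverses R w w') :
    RightReverses R (x ++ w) (x ++ w') := by
  simpa using h.append x []

theorem append_right {w w' : List (S × Bool)} (h : RightReverses R w w') (y : List (S × Bool)) :
    RightReverses R (w ++ y) (w' ++ y) := h.append [] y

theorem eq_of_pos_append_neg {p q : List S} {w : List (S × Bool)}
    (h : RightReverses R (pos p ++ neg q) w) : w = pos p ++ neg q := by
  obtain ⟨n, h⟩ := rightReverses_iff.1 h
  exact h.eq_of_pos_append_neg

theorem wordEqv {u v u' v' : List S} (h : RightReverses R (neg u ++ pos v) (pos v' ++ neg u')) :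
    WordEqv R (u ++ v') (v ++ u') := by
  obtain ⟨n, h⟩ := rightReverses_iff.1 h
  exact h.wordEqv

theorem wordEqv_of_nil {u v : List S} (h : RightReverses R (neg u ++ pos v) []) :
    WordEqv R u v := by
  simpa using wordEqv (u' := []) (v' := []) h

theorem invRev {w w' : List (S × Bool)} (h : RightReverses R w w') :
    RightReverses R (FreeGroup.invRev w) (FreeGroup.invRev w') :=
  Relation.ReflTransGen.lift FreeGroup.invRev (fun _ _ h => RightStep.invRev h) _ _ h

theorem nil_symm {u v : List S} (h : RightReverses R (neg u ++ pos v) []) :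
    RightReverses R (neg v ++ pos u) [] := by
  simpa [FreeGroup.invRev, pos, neg, Function.comp_def] using h.invRev

theorem neg_append_pos_self (u : List S) : RightReverses R (neg u ++ pos u) [] := by
  induction u with
  | nil => exact .refl
  | cons s u ih =>
    have h : RightStep R ([(s, false), (s, true)]) [] := by
      simpa using RightStep.head (R := R) (v := []) (v' := []) (Or.inr ⟨s, rfl, rfl⟩) []
    have := RightReverses.append (neg u) (pos u) (.single h)
    exact .trans (by simpa using this) ih

/-- Positive letters at the far left and negative letters at the far right would survive, so the
first factor becomes negative and the second positive. -/
theorem split {x y : List (S × Bool)} (h : RightReverses R (x ++ y) []) :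
    ∃ q p, RightReverses R x (neg q) ∧ RightReverses R y (pos p) ∧
      RightReverses R (neg q ++ pos p) [] := by
  obtain ⟨n, h⟩ := rightReverses_iff.1 h
  obtain ⟨p₁, q₁, p₂, q₂, _, _, _, h1, h2, h3, -⟩ := RightSteps.split (p := []) (q := []) h
  obtain ⟨a, b, h3, hp, hq⟩ := RightSteps.context (p := p₁) (q := q₂) (w := neg q₁ ++ pos p₂)
    (p' := []) (q' := []) (by simpa using h3)
  simp at hp hq
  obtain ⟨⟨rfl, rfl⟩, rfl, rfl⟩ := hp, hq
  exact ⟨q₁, p₂, h1.reverses, by simpa using h2.reverses, h3.reverses⟩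

/-- A reversing of `(b x)⁻¹ (c y)` to the empty word splits along the factorizations. -/
theorem factor {b x c y : List S} (h : RightReverses R (neg (b ++ x) ++ pos (c ++ y)) []) :
    ∃ e f z z', RightReverses R (neg b ++ pos c) (pos e ++ neg f) ∧
      RightReverses R (neg x ++ pos e) (neg z) ∧ RightReverses R (neg f ++ pos y) (pos z') ∧
      RightReverses R (neg z ++ pos z') [] := by
  obtain ⟨n, h⟩ := rightReverses_iff.1 h
  obtain ⟨e, f, _, _, h1, h2, -⟩ := RightSteps.split_middle (x := neg x) (w := neg b ++ pos c)
    (y := pos y) (p := []) (q := []) (by simpa using h)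
  obtain ⟨z, z', k1, k2, k3⟩ := split (x := neg x ++ pos e) (y := neg f ++ pos y)
    (by simpa using h2.reverses)
  exact ⟨e, f, z, z', h1.reverses, k1, k2, k3⟩

theorem of_factor {b x c y e f z z' : List S}
    (h : RightReverses R (neg b ++ pos c) (pos e ++ neg f))
    (h₁ : RightReverses R (neg x ++ pos e) (neg z)) (h₂ : RightReverses R (neg f ++ pos y) (pos z'))
    (h₃ : RightReverses R (neg z ++ pos z') []) :
    RightReverses R (neg (b ++ x) ++ pos (c ++ y)) [] := by
  have k := (h.append (neg x) (pos y)).trans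
    ((by simpa using h₁.append_right (neg f ++ pos y)) : RightReverses R _ _)
  simpa using k.trans ((h₂.append_left (neg z)).trans h₃)

theorem factor_right {x g k : List S} (h : RightReverses R (neg x ++ pos (g ++ k)) []) :
    ∃ m, RightReverses R (neg x ++ pos g) (neg m) ∧ RightReverses R (neg m ++ pos k) [] := by
  obtain ⟨q, p, h1, h2, h3⟩ := split (x := neg x ++ pos g) (y := pos k) (by simpa using h)
  have := eq_of_pos_append_neg (p := k) (q := []) (by simpa using h2)
  obtain ⟨rfl, -⟩ := pos_append_neg_inj (p := p) (q := []) (p' := k) (q' := []) (by simpa using this)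
  exact ⟨q, h1, h3⟩

theorem factor_left {x g k : List S} (h : RightReverses R (neg (g ++ k) ++ pos x) []) :
    ∃ m, RightReverses R (neg g ++ pos x) (pos m) ∧ RightReverses R (neg k ++ pos m) [] := by
  obtain ⟨m, h1, h2⟩ := factor_right h.nil_symm
  refine ⟨m, ?_, h2.nil_symm⟩
  simpa [FreeGroup.invRev, pos, neg, Function.comp_def] using h1.invRev

theorem wordEqv_of_pos {u v m : List S} (h : RightReverses R (neg u ++ pos v) (pos m)) :
    WordEqv R v (u ++ m) := by
  simpa using (wordEqv (u' := []) (v' := m) (by simpa using h)).symm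

theorem wordEqv_of_neg {u v m : List S} (h : RightReverses R (neg u ++ pos v) (neg m)) :
    WordEqv R u (v ++ m) := by
  simpa using wordEqv (u' := m) (v' := []) (by simpa using h)

end RightReverses

/-! ### Completeness of right-reversing and left cancellation. -/

theorem rightReverses_of_mem (hR : IsSemigroupPresentation R) {p q : List S} (h : (p, q) ∈ R) :
    RightReverses R (neg p ++ pos q) [] := by
  obtain ⟨hp, hq⟩ := hR _ h
  obtain ⟨s, p, rfl⟩ := List.exists_cons_of_ne_nil hp
  obtain ⟨t, q, rfl⟩ := List.exists_cons_of_ne_nil hq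
  have h' : RightReverses R (neg [s] ++ pos [t]) (pos p ++ neg q) := by
    exact .single (by simpa using RightStep.head (Or.inl (Or.inl h)) [])
  exact RightReverses.of_factor (b := [s]) (c := [t]) h'
    (z := []) (z' := []) (.neg_append_pos_self p) (.neg_append_pos_self q) .refl

/-- The first letters s, t, s' of the three words are peeled off. All equivalences between tails
concern words of smaller `ν`, where `ih` turns them into reversings; the cube condition on s, s', t
supplies the one comparison that still involves the first letters. -/
theorem rightReverses_trans_of_cube {n : ℕ} {ν : List S → ℕ}
    (hν : ∀ u v, WordEqv R u v → ν u = ν v) (hadd : ∀ u v, ν u + ν v ≤ ν (u ++ v))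
    (hpos : ∀ s, 1 ≤ ν [s]) (hcube : ∀ s s' s'' : S, RightCube R [s] [s'] [s''])
    (ih : ∀ u v, WordEqv R u v → ν u < n → RightReverses R (neg u ++ pos v) [])
    {u v w : List S} (hu : ν u < n + 1) (h₁ : RightReverses R (neg u ++ pos w) [])
    (h₂ : RightReverses R (neg w ++ pos v) []) : RightReverses R (neg u ++ pos v) [] := by
  have nil_right {x : List S} (h : RightReverses R (neg [] ++ pos x) []) : x = [] := by
    have := RightReverses.eq_of_pos_append_neg (p := x) (q := []) (by simpa using h)
    simpa using this.symm
  have lt_of_cons {s : S} {x : List S} (h : ν (s :: x) < n + 1) : ν x < n := by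
    have := hadd [s] x
    have := hpos s
    simp only [List.singleton_append] at *
    omega
  cases u with
  | nil => rwa [nil_right h₁] at h₂
  | cons s u =>
  cases w with
  | nil => rwa [nil_right h₂]
  | cons t w =>
  cases v with
  | nil => exact absurd (nil_right h₂.nil_symm) (by simp)
  | cons s' v =>
  have hw : ν w < n := lt_of_cons (by rwa [← hν _ _ h₁.wordEqv_of_nil])
  have hv : ν v < n := lt_of_cons (by rwa [← hν _ _ h₂.wordEqv_of_nil, ← hν _ _ h₁.wordEqv_of_nil])
  obtain ⟨a, b, y₁, x₂, hab, hu₁, hw₁, hyx⟩ := RightReverses.factor (b := [s]) (c := [t]) h₁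
  obtain ⟨c, d, y₂, x₃, hcd, hw₂, hv₁, hyx'⟩ := RightReverses.factor (b := [t]) (c := [s']) h₂
  have hbc : WordEqv R (b ++ x₂) (c ++ y₂) :=
    (RightReverses.wordEqv_of_pos hw₁).symm.trans (RightReverses.wordEqv_of_neg hw₂)
  obtain ⟨e, f, z, z', hef, hx₂, hy₂, hz⟩ := RightReverses.factor
    (ih _ _ hbc (by rwa [← hν _ _ (RightReverses.wordEqv_of_pos hw₁)]))
  -- The two corner tiles and the reversing of b⁻¹c assemble into the premise of the cube condition.
  have hcb : RightReverses R (neg [s] ++ pos [t] ++ neg [t] ++ pos [s'])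
      (pos (a ++ e) ++ neg (d ++ f)) := by
    have k₁ := hab.append_right (neg [t] ++ pos [s'])
    have k₂ := hcd.append_left (pos a ++ neg b)
    have k₃ := hef.append (pos a) (neg d)
    simp only [List.append_assoc, pos_append, neg_append] at k₁ k₂ k₃ ⊢
    exact k₁.trans (k₂.trans k₃)
  obtain ⟨g, h, k, k', hgh, hk, hk', hkk⟩ := RightReverses.factor (hcube s s' t _ _ hcb)
  have hz' := hz.wordEqv_of_nil
  -- The chain is u ≡ a y₁ ≡ a x₂ ≡ a e z ≡ g k z; symmetrically v ≡ h k' z' below.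
  have eu : WordEqv R u (g ++ (k ++ z)) := by
    have e₁ := (RightReverses.wordEqv_of_neg hu₁).trans (hyx.wordEqv_of_nil.append_left a)
    have e₂ := e₁.trans ((RightReverses.wordEqv_of_neg hx₂).append_left a)
    have e₃ := (RightReverses.wordEqv_of_neg hk).append_right z
    simp only [List.append_assoc] at e₂ e₃
    exact e₂.trans e₃
  have ev : WordEqv R v (h ++ (k' ++ z')) := by
    have e₁ := (RightReverses.wordEqv_of_pos hv₁).trans (hyx'.wordEqv_of_nil.symm.append_left d)
    have e₂ := e₁.trans ((RightReverses.wordEqv_of_pos hy₂).append_left d)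
    have e₃ := (RightReverses.wordEqv_of_pos hk').append_right z'
    simp only [List.append_assoc] at e₂ e₃
    exact e₂.trans e₃
  obtain ⟨m, hm, hmk⟩ := RightReverses.factor_right (ih _ _ eu (lt_of_cons hu))
  obtain ⟨l, hl, hlk⟩ := RightReverses.factor_left (ih _ _ ev hv).nil_symm
  have hml : WordEqv R m l := hmk.wordEqv_of_nil.trans
    ((hkk.wordEqv_of_nil.append hz').trans hlk.wordEqv_of_nil)
  -- Superadditivity applies because u ≡ g m.
  have hmn : ν m < n := by
    have := hν _ _ (RightReverses.wordEqv_of_neg hm)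
    have := hadd g m
    have := lt_of_cons hu
    omega
  exact RightReverses.of_factor (b := [s]) (c := [s']) hgh hm hl (ih _ _ hml hmn)

/-- Under the cube condition on letters, and in presence of a superadditive length function,
right-reversing detects the equivalence of positive words. -/
theorem WordEqv.rightReverses (hR : IsSemigroupPresentation R) {ν : List S → ℕ}
    (hν : ∀ u v, WordEqv R u v → ν u = ν v) (hadd : ∀ u v, ν u + ν v ≤ ν (u ++ v))
    (hpos : ∀ s, 1 ≤ ν [s]) (hcube : ∀ s s' s'' : S, RightCube R [s] [s'] [s''])
    {u v : List S} (h : WordEqv R u v) : RightReverses R (neg u ++ pos v) [] := by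
  suffices ∀ n u v, WordEqv R u v → ν u < n → RightReverses R (neg u ++ pos v) [] from
    this _ u v h (Nat.lt_succ_self _)
  intro n
  induction n with
  | zero => intro u v _ h; omega
  | succ n ih =>
    intro u v h hu
    -- Inner induction on the derivation of the equivalence; the outer hypothesis `ih` serves only
    -- for transitivity.
    induction h with
    | rel p q h => exact rightReverses_of_mem hR h
    | refl u => exact .neg_append_pos_self u
    | symm h ih' => exact (ih' (by rwa [hν _ _ h])).nil_symm
    | trans h h' ih₁ ih₂ =>
      exact rightReverses_trans_of_cube hν hadd hpos hcube ih hu (ih₁ hu)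
        (ih₂ (by rwa [← hν _ _ h]))
    | @append u v u' v' h h' ih₁ ih₂ =>
      have := hadd u u'
      have k := (ih₁ (by omega)).append (neg u') (pos v')
      have k' := ih₂ (by omega)
      simp only [List.append_assoc, pos_append, neg_append, List.nil_append] at k k' ⊢
      exact k.trans k'

/-- If right-reversing detects equivalence, a presentation without relations `s v = s v'` with
`v ≠ v'` presents a left-cancellative monoid. -/
theorem WordEqv.of_cons
    (hcomplete : ∀ u v, WordEqv R u v → RightReverses R (neg u ++ pos v) [])
    (hrel : ∀ (s : S) (v v' : List S), v ≠ v' → ¬ IsRelation R (s :: v) (s :: v'))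
    {s : S} {u v : List S} (h : WordEqv R (s :: u) (s :: v)) : WordEqv R u v := by
  obtain ⟨e, f, z, z', hef, hz, hz', hzz⟩ :=
    RightReverses.factor (b := [s]) (c := [s]) (hcomplete _ _ h)
  obtain ⟨n, hn⟩ := rightReverses_iff.1 hef
  have hr := (RightSteps.letters (by simpa using hn)).2
  -- The corner tile is a relation s e = s f, so the hypothesis on relations forces e = f.
  obtain rfl : e = f := by
    by_contra hne
    rcases hr with hr | ⟨t, h1, h2⟩
    · exact hrel s e f hne hr
    · simp at h1 h2
      exact hne (h1.2.trans h2.2.symm)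
  exact (RightReverses.wordEqv_of_neg hz).trans ((hzz.wordEqv_of_nil.append_left e).trans
    (RightReverses.wordEqv_of_pos hz').symm)

/-! ### Mirror symmetry between left- and right-reversing. -/

/-- The presentation in which all relations are read from right to left. -/
def mirror (R : Set (List S × List S)) : Set (List S × List S) :=
  {p | (p.1.reverse, p.2.reverse) ∈ R}

theorem mirror_mirror : mirror (mirror R) = R := by
  ext ⟨u, v⟩
  simp [mirror]

@[simp] theorem reverse_pos (u : List S) : (pos u).reverse = pos u.reverse := by
  simp [pos]

@[simp] theorem reverse_neg (u : List S) : (neg u).reverse = neg u.reverse := by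
  simp [neg]

theorem isRelationOrTrivial_mirror {u v : List S} :
    IsRelationOrTrivial (mirror R) u v ↔ IsRelationOrTrivial R u.reverse v.reverse := by
  simp [IsRelationOrTrivial, IsRelation, mirror]

/-- Plain list reversal keeps the signs of the letters, so it turns s's⁻¹ into s⁻¹s'; formal
inversion would instead preserve the direction of reversing. -/
theorem LeftStep.reverse {w w' : List (S × Bool)} (h : LeftStep R w w') :
    RightStep (mirror R) w.reverse w'.reverse := by
  obtain ⟨x, y, s, s', v, v', h⟩ := h
  have h' : IsRelationOrTrivial (mirror R) (s :: v'.reverse) (s' :: v.reverse) :=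
    isRelationOrTrivial_mirror.2 (by simpa using h.symm)
  simpa using RightStep.step y.reverse x.reverse s s' v.reverse v'.reverse h'

theorem RightStep.reverse {w w' : List (S × Bool)} (h : RightStep (mirror R) w w') :
    LeftStep R w.reverse w'.reverse := by
  obtain ⟨x, y, s, s', v, v', h⟩ := h
  have h' : IsRelationOrTrivial R (v.reverse ++ [s']) (v'.reverse ++ [s]) := by
    simpa using (isRelationOrTrivial_mirror.1 h).symm
  simpa using LeftStep.step y.reverse x.reverse s s' v.reverse v'.reverse h'

theorem LeftReverses.reverse {w w' : List (S × Bool)} (h : LeftReverses R w w') :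
    RightReverses (mirror R) w.reverse w'.reverse :=
  Relation.ReflTransGen.lift List.reverse (fun _ _ h => LeftStep.reverse h) _ _ h

theorem RightReverses.reverse {w w' : List (S × Bool)} (h : RightReverses (mirror R) w w') :
    LeftReverses R w.reverse w'.reverse :=
  Relation.ReflTransGen.lift List.reverse (fun _ _ h => RightStep.reverse h) _ _ h

theorem LeftCube.mirror {s s' s'' : S} (h : LeftCube R [s] [s'] [s'']) :
    RightCube (mirror R) [s] [s'] [s''] := by
  intro v v' hv
  have := (h v.reverse v'.reverse (by simpa using hv.reverse)).reverse
  simpa using this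

theorem WordEqv.reverse {u v : List S} (h : WordEqv (mirror R) u v) :
    WordEqv R u.reverse v.reverse := by
  induction h with
  | rel p q h => exact .rel _ _ h
  | refl u => exact .refl _
  | symm _ ih => exact ih.symm
  | trans _ _ ih ih' => exact ih.trans ih'
  | append _ _ ih ih' => simpa using ih'.append ih

theorem wordEqv_mirror {u v : List S} :
    WordEqv (mirror R) u v ↔ WordEqv R u.reverse v.reverse := by
  refine ⟨WordEqv.reverse, fun h => ?_⟩
  rw [← mirror_mirror (R := R)] at h
  simpa using h.reverse

/-! ### Word equivalence as equality in the presented monoid. -/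

/-- The class of a positive word in the presented monoid. -/
def monoidMk (R : Set (List S × List S)) (u : List S) : PresMonoid R :=
  PresentedMonoid.mk _ (FreeMonoid.ofList u)

theorem monoidMk_append (u v : List S) : monoidMk R (u ++ v) = monoidMk R u * monoidMk R v :=
  map_mul (PresentedMonoid.mk _) (FreeMonoid.ofList u) (FreeMonoid.ofList v)

theorem monoidMk_surjective : Function.Surjective (monoidMk R) := fun x => by
  obtain ⟨a, rfl⟩ := PresentedMonoid.surjective_mk x
  exact ⟨a.toList, rfl⟩

theorem monoidMk_eq_iff {u v : List S} : monoidMk R u = monoidMk R v ↔ WordEqv R u v := by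
  constructor
  · intro h
    have h : ConGen.Rel (fun a b : FreeMonoid S => (a.toList, b.toList) ∈ R)
      (FreeMonoid.ofList u) (FreeMonoid.ofList v) := PresentedMonoid.mk_eq_mk_iff.1 h
    suffices ∀ a b : FreeMonoid S, ConGen.Rel (fun a b => (a.toList, b.toList) ∈ R) a b →
      WordEqv R a.toList b.toList from this _ _ h
    intro a b h
    induction h with
    | of x y h => exact .rel _ _ h
    | refl x => exact .refl _
    | symm _ ih => exact ih.symm
    | trans _ _ ih ih' => exact ih.trans ih'
    | mul _ _ ih ih' => exact ih.append ih'
  · intro h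
    induction h with
    | rel p q h => exact PresentedMonoid.mk_eq_mk_of_rel h
    | refl u => rfl
    | symm _ ih => exact ih.symm
    | trans _ _ ih ih' => exact ih.trans ih'
    | append _ _ ih ih' => rw [monoidMk_append, monoidMk_append, ih, ih']

/-! ### Existence and uniqueness of the positive-negative form. -/

/-- Every signed word reverses to a positive-negative word as soon as some set of words that
includes the letters is closed under right-reversing. -/
theorem exists_rightReverses
    (h : ∃ T : Set (List S), (∀ s : S, [s] ∈ T) ∧ ∀ u ∈ T, ∀ u' ∈ T, ∃ v ∈ T, ∃ v' ∈ T,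
      RightReverses R (neg u ++ pos u') (pos v' ++ neg v)) (w : List (S × Bool)) :
    ∃ v v' : List S, RightReverses R w (pos v' ++ neg v) := by
  obtain ⟨T, hletter, hT⟩ := h
  -- Only the denominator has to remain in `T`, because it is what meets the next word of `L`.
  have key : ∀ L : List (List S), (∀ x ∈ L, x ∈ T) → ∀ u ∈ T,
      ∃ v ∈ T, ∃ v', RightReverses R (neg u ++ pos L.flatten) (pos v' ++ neg v) := by
    intro L
    induction L with
    | nil => exact fun _ u hu => ⟨u, hu, [], by simpa using .refl⟩
    | cons x L ih =>
      intro hL u hu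
      obtain ⟨v, hv, v', -, h⟩ := hT u hu x (hL x (by simp))
      obtain ⟨y, hy, y', h'⟩ := ih (fun x hx => hL x (by simp [hx])) v hv
      refine ⟨y, hy, v' ++ y', ?_⟩
      have k := h.append_right (pos L.flatten)
      have k' := h'.append_left (pos v')
      simp only [List.append_assoc, pos_append, List.flatten_cons] at k k' ⊢
      exact k.trans k'
  induction w with
  | nil => exact ⟨[], [], .refl⟩
  | cons c w ih =>
    obtain ⟨v, v', h⟩ := ih
    obtain ⟨s, _ | _⟩ := c
    -- `v'` is cut into its letters, all of which belong to `T`.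
    · obtain ⟨y, -, y', hy⟩ := key (v'.map fun t => [t]) (by simpa using fun a _ => hletter a)
        [s] (hletter s)
      have hfl : (v'.map fun t => [t]).flatten = v' := by
        rw [← List.flatMap_def, List.flatMap_singleton']
      rw [hfl] at hy
      refine ⟨v ++ y, y', ?_⟩
      have k := h.append_left [(s, false)]
      have k' := hy.append_right (neg v)
      simp only [List.append_assoc, neg_append, neg_cons, neg_nil, List.nil_append,
        List.singleton_append] at k k' ⊢
      exact k.trans k'
    · exact ⟨v, s :: v', h.append_left [(s, true)]⟩

/-- Two reducible factors at different positions are disjoint, since each is a negative letter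
followed by a positive one, so the steps commute; at the same position the results agree by
complementedness. -/
theorem Complemented.diamond (hR : Complemented R) {w a b : List (S × Bool)}
    (ha : RightStep R w a) (hb : RightStep R w b) :
    a = b ∨ ∃ c, RightStep R a c ∧ RightStep R b c := by
  induction w generalizing a b with
  | nil => exact absurd ha RightStep.not_nil
  | cons c w ih =>
    have aux {s s' : S} {v v' : List S} {y z : List (S × Bool)}
        (hr : IsRelationOrTrivial R (s :: v') (s' :: v)) (hz : RightStep R ((s', true) :: y) z) :
        ∃ d, RightStep R (pos v' ++ neg v ++ y) d ∧ RightStep R ((s, false) :: z) d := by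
      rcases hz.cons_cases with ⟨_, _, _, _, _, h, -⟩ | ⟨y', hy, rfl⟩
      · simp at h
      · exact ⟨_, hy.append_left _, RightStep.head hr y'⟩
    rcases ha.cons_cases with ⟨s, s', v, v', y, rfl, rfl, hr, rfl⟩ | ⟨a, ha', rfl⟩ <;>
    rcases hb.cons_cases with ⟨t, t', x, x', z, h1, h2, hr', rfl⟩ | ⟨b, hb', rfl⟩
    · simp at h1 h2
      obtain ⟨rfl, rfl⟩ := h2
      subst h1
      obtain ⟨rfl, rfl⟩ := hR _ _ _ _ _ _ hr hr'
      exact Or.inl rfl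
    · exact Or.inr (aux hr hb')
    · subst h1 h2
      obtain ⟨d, h, h'⟩ := aux hr' ha'
      exact Or.inr ⟨d, h', h⟩
    · rcases ih ha' hb' with rfl | ⟨d, h, h'⟩
      · exact Or.inl rfl
      · exact Or.inr ⟨_, h.append_left [c], h'.append_left [c]⟩

theorem Complemented.unique (hR : Complemented R) {w : List (S × Bool)} {p q p' q' : List S}
    (h : RightReverses R w (pos p ++ neg q)) (h' : RightReverses R w (pos p' ++ neg q')) :
    p = p' ∧ q = q' := by
  obtain ⟨d, h₁, h₂⟩ := Relation.church_rosser (fun a b c hab hac => by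
    rcases hR.diamond hab hac with rfl | ⟨d, h, h'⟩
    · exact ⟨b, .refl, .refl⟩
    · exact ⟨d, .single h, .single h'⟩) h h'
  exact pos_append_neg_inj ((RightReverses.eq_of_pos_append_neg h₁).symm.trans
    (RightReverses.eq_of_pos_append_neg h₂))

/-! ### Embedding in a group, and evaluation of signed words. -/

/-- Ore's theorem: a cancellative monoid with common right multiples embeds in a group. -/
theorem exists_injective_monoidHom_group {M : Type u} [Monoid M]
    (hl : ∀ a b c : M, a * b = a * c → b = c) (hr : ∀ a b c : M, a * c = b * c → a = b)
    (hm : ∀ a b : M, ∃ c d, a * c = b * d) :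
    ∃ (H : Type u) (_ : Group H) (f : M →* H), Function.Injective f := by
  choose c d hcd using hm
  -- `OreSet` asks for common left multiples, hence the opposite monoid; the inverse in the
  -- homomorphism below undoes the change of order.
  let _ : OreLocalization.OreSet (⊤ : Submonoid Mᵐᵒᵖ) :=
    { ore_right_cancel := fun r₁ r₂ s h => ⟨1, by
        rw [MulOpposite.unop_injective (hl _ _ _ (congrArg MulOpposite.unop h))]⟩
      oreNum := fun r s => .op (d r.unop s.1.unop)
      oreDenom := fun r s => ⟨.op (c r.unop s.1.unop), trivial⟩
      ore_eq := fun r s => congrArg MulOpposite.op (hcd r.unop s.1.unop) }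
  refine ⟨(OreLocalization (⊤ : Submonoid Mᵐᵒᵖ) Mᵐᵒᵖ)ˣ, inferInstance, MonoidHom.mk'
    (fun x => (OreLocalization.numeratorUnit ⟨.op x, trivial⟩)⁻¹) ?_, ?_⟩
  · intro x y
    rw [← mul_inv_rev, inv_inj]
    ext
    exact map_mul (OreLocalization.numeratorHom (S := (⊤ : Submonoid Mᵐᵒᵖ)))
      (MulOpposite.op y) (MulOpposite.op x)
  · intro x y h
    have h := congrArg Units.val (inv_injective h)
    obtain ⟨u, v, h1, h2⟩ := OreLocalization.oreDiv_eq_iff.1 h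
    -- Both denominators are 1, so the two multipliers coincide and right cancellation concludes.
    have huv : (u : Mᵐᵒᵖ) = v := by simpa using h2
    subst huv
    exact (hr _ _ _ (congrArg MulOpposite.unop h1)).symm

theorem evalGroup_append (x y : List (S × Bool)) :
    evalGroup R (x ++ y) = evalGroup R x * evalGroup R y := by
  rw [evalGroup, ← FreeGroup.mul_mk, map_mul]
  rfl

theorem evalGroup_neg (u : List S) : evalGroup R (neg u) = (evalGroup R (pos u))⁻¹ := by
  rw [evalGroup, evalGroup, ← map_inv, FreeGroup.inv_mk]
  congr 2
  simp [FreeGroup.invRev, pos, neg, Function.comp_def]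

theorem IsRelationOrTrivial.evalGroup_eq {u v : List S} (h : IsRelationOrTrivial R u v) :
    evalGroup R (pos u) = evalGroup R (pos v) := by
  have aux {u v : List S} (h : (u, v) ∈ R) : evalGroup R (pos u) = evalGroup R (pos v) := by
    rw [← mul_inv_eq_one, evalGroup, evalGroup, ← map_inv, ← map_mul]
    exact PresentedGroup.one_of_mem ⟨_, h, rfl⟩
  rcases h with (h | h) | ⟨s, rfl, rfl⟩
  · exact aux h
  · exact (aux h).symm
  · rfl

theorem RightReverses.evalGroup_eq {w w' : List (S × Bool)} (h : RightReverses R w w') :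
    evalGroup R w = evalGroup R w' := by
  induction h with
  | refl => rfl
  | tail _ h ih =>
    rw [ih]
    obtain ⟨x, y, s, s', v, v', h⟩ := h
    have e := h.evalGroup_eq
    rw [← List.singleton_append, ← List.singleton_append (l := v), pos_append, pos_append,
      evalGroup_append, evalGroup_append] at e
    simp only [evalGroup_append, evalGroup_neg]
    have e' : (evalGroup R (pos [s]))⁻¹ * evalGroup R (pos [s']) =
        evalGroup R (pos v') * (evalGroup R (pos v))⁻¹ := by
      rw [inv_mul_eq_iff_eq_mul, ← mul_assoc, e, mul_inv_cancel_right]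
    rw [mul_assoc (evalGroup R x), e', ← mul_assoc (evalGroup R x)]

/-- A monoid homomorphism from the presented monoid to a group factors through the presented
group. -/
theorem exists_monoidHom_presGroup {H : Type*} [Group H] (f : PresMonoid R →* H) :
    ∃ F : PresGroup R →* H, ∀ u : List S, F (evalGroup R (pos u)) = f (monoidMk R u) := by
  have key (u : List S) : FreeGroup.lift (fun s => f (monoidMk R [s])) (FreeGroup.mk (pos u)) =
      f (monoidMk R u) := by
    induction u with
    | nil => exact (map_one f).symm
    | cons s u ih =>
      rw [← List.singleton_append, monoidMk_append, map_mul, ← ih, pos_append, ← FreeGroup.mul_mk,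
        map_mul]
      congr 1
      simp
  refine ⟨PresentedGroup.toGroup (f := fun s => f (monoidMk R [s])) ?_, key⟩
  rintro _ ⟨⟨p, q⟩, h, rfl⟩
  rw [map_mul, map_inv, key, key, mul_inv_eq_one, monoidMk_eq_iff.2 (.rel _ _ h)]

theorem WordEqv.of_append_left (h : ∀ (s : S) (u v : List S), WordEqv R (s :: u) (s :: v) →
    WordEqv R u v) {x u v : List S} (huv : WordEqv R (x ++ u) (x ++ v)) : WordEqv R u v := by
  induction x with
  | nil => exact huv
  | cons s x ih => exact ih (h s _ _ huv)

end SubwordReversing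

/-! ### The main theorem. -/

theorem theoremT {S : Type*} {G : Type*} [Group G] (R : Set (List S × List S))
    -- `(S, R)` is a semigroup presentation of the group `G`
    (hR : SubwordReversing.IsSemigroupPresentation R)
    (e : SubwordReversing.PresGroup R ≃* G)
    -- no relation `s v = s v'` or `v s = v' s` with `v ≠ v'`
    (h_left : ∀ (s : S) (v v' : List S),
      v ≠ v' → ¬ SubwordReversing.IsRelation R (s :: v) (s :: v'))
    (h_right : ∀ (s : S) (v v' : List S),
      v ≠ v' → ¬ SubwordReversing.IsRelation R (v ++ [s]) (v' ++ [s]))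
    -- a superadditive pseudolength on the presented monoid
    (h_length : ∃ l : SubwordReversing.PresMonoid R → ℕ,
      (∀ x y, l x + l y ≤ l (x * y)) ∧ ∀ s : S, 1 ≤ l (PresentedMonoid.of _ s))
    (h_compl : SubwordReversing.Complemented R)
    -- the right and left cube conditions on letters
    (h_rcube : ∀ s s' s'' : S, SubwordReversing.RightCube R [s] [s'] [s''])
    (h_lcube : ∀ s s' s'' : S, SubwordReversing.LeftCube R [s] [s'] [s''])
    -- a set of words that includes the letters and is closed under right-reversing
    (h_closed : ∃ T : Set (List S), (∀ s : S, [s] ∈ T) ∧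
      ∀ u ∈ T, ∀ u' ∈ T, ∃ v ∈ T, ∃ v' ∈ T,
        SubwordReversing.RightReverses R (SubwordReversing.neg u ++ SubwordReversing.pos u')
          (SubwordReversing.pos v' ++ SubwordReversing.neg v))
    (w : List (S × Bool)) :
    (∃! p : List S × List S,
      SubwordReversing.RightReverses R w
        (SubwordReversing.pos p.2 ++ SubwordReversing.neg p.1)) ∧
    ∀ v v' : List S,
      SubwordReversing.RightReverses R w (SubwordReversing.pos v' ++ SubwordReversing.neg v) →
        (e (SubwordReversing.evalGroup R w) = 1 ↔
          SubwordReversing.RightReverses R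
            (SubwordReversing.neg v ++ SubwordReversing.pos v') []) := by
  open SubwordReversing in
  obtain ⟨l, hl, hl1⟩ := h_length
  have hν (u v : List S) (h : WordEqv R u v) : l (monoidMk R u) = l (monoidMk R v) := by
    rw [monoidMk_eq_iff.2 h]
  have hadd (u v : List S) : l (monoidMk R u) + l (monoidMk R v) ≤ l (monoidMk R (u ++ v)) := by
    rw [monoidMk_append]
    exact hl _ _
  have hcomplete (u v : List S) (h : WordEqv R u v) : RightReverses R (neg u ++ pos v) [] :=
    h.rightReverses hR hν hadd hl1 h_rcube
  have hcomplete' (u v : List S) (h : WordEqv (mirror R) u v) :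
      RightReverses (mirror R) (neg u ++ pos v) [] := by
    -- The pseudolength of the mirror presentation is that of the reversed word; the left cube
    -- condition becomes its right cube condition.
    refine h.rightReverses (ν := fun u => l (monoidMk R u.reverse)) ?_ (fun u v h => hν _ _ h.reverse)
      (fun u v => ?_) hl1 (fun s s' s'' => (h_lcube s s' s'').mirror)
    · intro p hp
      simpa using hR _ hp
    · rw [List.reverse_append, add_comm]
      exact hadd _ _
  have hexists := exists_rightReverses h_closed
  obtain ⟨H, _, φ, hφ⟩ := exists_injective_monoidHom_group (M := PresMonoid R)
    (fun a b c h => by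
      obtain ⟨a, rfl⟩ := monoidMk_surjective a
      obtain ⟨b, rfl⟩ := monoidMk_surjective b
      obtain ⟨c, rfl⟩ := monoidMk_surjective c
      rw [← monoidMk_append, ← monoidMk_append, monoidMk_eq_iff] at h
      exact monoidMk_eq_iff.2 (h.of_append_left fun _ _ _ => WordEqv.of_cons hcomplete h_left))
    (fun a b c h => by
      obtain ⟨a, rfl⟩ := monoidMk_surjective a
      obtain ⟨b, rfl⟩ := monoidMk_surjective b
      obtain ⟨c, rfl⟩ := monoidMk_surjective c
      rw [← monoidMk_append, ← monoidMk_append, monoidMk_eq_iff] at h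
      have h' : WordEqv (mirror R) (c.reverse ++ a.reverse) (c.reverse ++ b.reverse) :=
        wordEqv_mirror.2 (by simpa using h)
      have hrel (s : S) (v v' : List S) (hv : v ≠ v') :
          ¬ IsRelation (mirror R) (s :: v) (s :: v') := by
        simpa [IsRelation, mirror] using h_right s v.reverse v'.reverse (by simpa using hv)
      simpa using monoidMk_eq_iff.2
        (h'.of_append_left fun _ _ _ => WordEqv.of_cons hcomplete' hrel).reverse)
    (fun a b => by
      obtain ⟨a, rfl⟩ := monoidMk_surjective a
      obtain ⟨b, rfl⟩ := monoidMk_surjective b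
      -- Reversing a⁻¹b to v'v⁻¹ yields the common right multiple a v' = b v.
      obtain ⟨v, v', h⟩ := hexists (neg a ++ pos b)
      refine ⟨monoidMk R v', monoidMk R v, ?_⟩
      rw [← monoidMk_append, ← monoidMk_append, monoidMk_eq_iff]
      exact h.wordEqv)
  obtain ⟨F, hF⟩ := exists_monoidHom_presGroup φ
  constructor
  · obtain ⟨v, v', h⟩ := hexists w
    refine ⟨(v, v'), h, ?_⟩
    rintro ⟨x, x'⟩ hx
    obtain ⟨rfl, rfl⟩ := h_compl.unique hx h
    rfl
  · intro v v' h
    rw [EmbeddingLike.map_eq_one_iff, h.evalGroup_eq, evalGroup_append, evalGroup_neg,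
      mul_inv_eq_one]
    constructor
    · intro h
      -- The embedding `φ` factors through G's presentation, so an equality of positive words in the
      -- group already holds in the monoid.
      have h := congrArg F h
      rw [hF, hF] at h
      exact hcomplete _ _ (monoidMk_eq_iff.1 (hφ h)).symm
    · intro h
      have h := h.evalGroup_eq
      rw [evalGroup_append, evalGroup_neg, inv_mul_eq_iff_eq_mul] at h
      rw [h]
      exact mul_one _
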